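/- Let $G$ be a finite group, let $\mathrm{Irr}(G)=\{\chi_1,\dots,\chi_n\}$ be the set of its irreducible complex characters, so $n=|\mathrm{Irr}(G)|$, and let $X(G)$ be the ordinary character table of $G$: its rows are indexed by $\mathrm{Irr}(G)$, its columns by the conjugacy classes of $G$, and the entry at $(\chi,C)$ is the value of $\chi$ on $C$. Let $$s(G)=\sum_{\chi\in\mathrm{Irr}(G)}\ \sum_{C}\chi(C)$$ be the sum of all entries of $X(G)$, and let $A$ be an abelian subgroup of $G$ of maximal order (among all abelian subgroups of $G$). Then: (1) $s(G)$ is an integer and $\max(n,|A|)\le s(G)\le |G|$. (2) For every conjugacy class $C$ of $G$, the column sum $\sum_{\chi\in\mathrm{Irr}(G)}\chi(C)$ is an integer. Moreover, the lower bound in (1) is in general sharper than Solomon's lower bound $|A|\le s(G)$: there is a finite group $H$ with an abelian subgroup $A$ of maximal order such that $|A|<|\mathrm{Irr}(H)|$. -/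

import Mathlib

namespace OrdinaryCharacterTable

/-- The set `Irr(G)` of irreducible complex characters of `G`. Every finite-dimensional complex
representation is isomorphic to one on some `Fin d → ℂ`, so only these spaces are needed. -/
def Irr (G : Type*) [Group G] : Set (G → ℂ) :=
  {χ | ∃ (d : ℕ) (ρ : Representation ℂ G (Fin d → ℂ)), ρ.IsIrreducible ∧ ρ.character = χ}

/-- Irreducible characters are class functions. -/
theorem Irr.apply_eq_of_isConj {G : Type*} [Group G] {χ : G → ℂ} (hχ : χ ∈ Irr G) {g h : G}
    (hgh : IsConj g h) : χ g = χ h := by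
  obtain ⟨d, ρ, -, rfl⟩ := hχ
  obtain ⟨c, rfl⟩ := isConj_iff.mp hgh
  exact (ρ.char_conj g c).symm

/-- A finite group has only finitely many irreducible characters: they are orthonormal, hence
linearly independent. -/
instance Irr.instFinite (G : Type*) [Group G] [Finite G] : Finite (Irr G) := by
  classical
  have := Fintype.ofFinite G
  have hc : (Nat.card G : ℂ) ≠ 0 := by exact_mod_cast Nat.card_pos.ne'
  have : Invertible (Nat.card G : ℂ) := invertibleOfNonzero hc
  have orth : ∀ χ ψ : Irr G, (Nat.card G : ℂ)⁻¹ * ∑ g : G, χ.1 g * ψ.1 g⁻¹ =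
      if χ = ψ then 1 else 0 := by
    rintro ⟨χ, d, ρ, hρ, rfl⟩ ⟨ψ, e, σ, hσ, rfl⟩
    have key := Representation.char_orthonormal ρ σ
    have self := Representation.char_orthonormal ρ ρ
    rw [if_pos ⟨Representation.Equiv.refl ρ⟩] at self
    by_cases h : ρ.character = σ.character
    · simp only [h, if_true]
      rw [h] at self
      exact self
    · rw [if_neg (by rintro ⟨f⟩; exact h (Representation.char_iso f).symm)] at key
      rw [if_neg fun e => h (congrArg Subtype.val e)]
      exact key
  have li : LinearIndependent ℂ (fun χ : Irr G => χ.1) := by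
    rw [linearIndependent_iff']
    intro s c hs ψ hψ
    have h0 : ∑ χ ∈ s, c χ * ((Nat.card G : ℂ)⁻¹ * ∑ g : G, χ.1 g * ψ.1 g⁻¹) = 0 := by
      have h1 : ∀ g : G, ∑ χ ∈ s, c χ * χ.1 g = 0 := by
        intro g
        simpa using congrFun hs g
      calc ∑ χ ∈ s, c χ * ((Nat.card G : ℂ)⁻¹ * ∑ g : G, χ.1 g * ψ.1 g⁻¹)
          = (Nat.card G : ℂ)⁻¹ * ∑ g : G, (∑ χ ∈ s, c χ * χ.1 g) * ψ.1 g⁻¹ := by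
            simp only [Finset.mul_sum, Finset.sum_mul]
            rw [Finset.sum_comm]
            refine Finset.sum_congr rfl fun g _ => Finset.sum_congr rfl fun χ _ => ?_
            ring
        _ = 0 := by simp [h1]
    simp only [orth] at h0
    simpa [hψ] using h0
  exact li.finite

noncomputable instance Irr.instFintype (G : Type*) [Group G] [Finite G] : Fintype (Irr G) :=
  Fintype.ofFinite _

/-- The ordinary character table `X(G)`: rows are indexed by the irreducible characters, columns
by the conjugacy classes, and the entry at `(χ, C)` is the value of `χ` on `C`. -/
def charTable (G : Type*) [Group G] : Matrix (Irr G) (ConjClasses G) ℂ :=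
  fun χ C => Quotient.liftOn C χ.1 fun _ _ h => Irr.apply_eq_of_isConj χ.2 h

/-- The sum of the column of the character table belonging to the conjugacy class `C`. -/
noncomputable def columnSum (G : Type*) [Group G] [Finite G] (C : ConjClasses G) : ℂ :=
  ∑ χ : Irr G, charTable G χ C

/-- The sum `s(G)` of all entries of the character table. -/
noncomputable def tableSum (G : Type*) [Group G] [Finite G] : ℂ :=
  letI : Fintype (ConjClasses G) := Fintype.ofFinite _
  ∑ χ : Irr G, ∑ C : ConjClasses G, charTable G χ C

/-- `A` is an abelian subgroup of `G` of maximal order (among all abelian subgroups of `G`). -/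
def IsMaxOrderAbelian {G : Type*} [Group G] (A : Subgroup G) : Prop :=
  IsMulCommutative A ∧ ∀ B : Subgroup G, IsMulCommutative B → Nat.card B ≤ Nat.card A

end OrdinaryCharacterTable

/-! Let `m χ` be the sum of row `χ`. The permutation character `π` of `G` acting on itself by
conjugation has `π(g) = |C_G(g)|`, so by orbit-stabilizer `m χ` is the multiplicity of `χ` in `π`, a
natural number (`exists_nat_row_sum`). Weighting rows by degrees turns each column sum into a value
of the regular character, so `∑ χ(1) m χ = |G|` (`sum_degree_mul_row_sum`). Both `s ≤ |G|` and `|A|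
≤ s` follow from `1 ≤ χ(1) ≤ [G : A]`. The trivial row alone contributes the number of classes,
which is at least `n`, and the other rows are nonnegative, so `n ≤ s`.

A column sum is an algebraic integer, and every automorphism of `ℂ` fixes it because it permutes
`Irr G`. An algebraic number fixed by all of `Aut(ℂ)` is rational, hence here an integer.

The strict example is the dihedral group of order 8, where `|A| = 4` and there are at least five
irreducible characters. -/

namespace OrdinaryCharacterTable

open Module Cardinal

universe u v

/-! ### Decomposition of characters into irreducibles -/

/-- The trace of an endomorphism preserving two complementary subspaces is the sum of the traces of
its restrictions. -/
theorem trace_eq_add_of_isCompl {k V : Type*} [Field k] [AddCommGroup V] [Module k V]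
    [FiniteDimensional k V] {p q : Submodule k V} (h : IsCompl p q) (f : V →ₗ[k] V)
    (hp : ∀ v ∈ p, f v ∈ p) (hq : ∀ v ∈ q, f v ∈ q) :
    LinearMap.trace k V f =
      LinearMap.trace k p (f.restrict hp) + LinearMap.trace k q (f.restrict hq) := by
  rw [← LinearMap.trace_prodMap', ← LinearMap.trace_conj' _ (Submodule.prodEquivOfIsCompl p q h)]
  congr 1
  refine LinearMap.ext fun v => ?_
  obtain ⟨⟨a, b⟩, rfl⟩ := (Submodule.prodEquivOfIsCompl p q h).surjective v
  simp [LinearEquiv.conj_apply]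

/-- The character of an irreducible representation on an arbitrary finite-dimensional space lies
in `Irr(G)`. -/
theorem character_mem_Irr {G V : Type*} [Group G] [AddCommGroup V] [Module ℂ V]
    [FiniteDimensional ℂ V] (ρ : Representation ℂ G V) [hρ : ρ.IsIrreducible] :
    ρ.character ∈ Irr G := by
  let e : V ≃ₗ[ℂ] (Fin (finrank ℂ V) → ℂ) := (finBasis ℂ V).equivFun
  let σ : Representation ℂ G (Fin (finrank ℂ V) → ℂ) :=
    { toFun := fun g => e.conj (ρ g)
      map_one' := by rw [map_one]; exact LinearEquiv.conj_id e
      map_mul' := fun g h => by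
        rw [map_mul]; exact LinearEquiv.conj_comp e (ρ h) (ρ g) }
  let φ : ρ.Equiv σ := Representation.Equiv.mk e fun g => by
    ext v; simp [σ, LinearEquiv.conj_apply]
  refine ⟨_, σ, ?_, (Representation.char_iso φ).symm⟩
  let F : Subrepresentation σ ≃o Subrepresentation ρ :=
    { toFun := fun s => ⟨s.toSubmodule.comap e.toLinearMap, fun g v hv => by
        have := s.apply_mem_toSubmodule g hv
        simpa [σ, LinearEquiv.conj_apply] using this⟩
      invFun := fun s => ⟨s.toSubmodule.comap e.symm.toLinearMap, fun g v hv => by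
        have := s.apply_mem_toSubmodule g hv
        simpa [σ, LinearEquiv.conj_apply] using this⟩
      left_inv := fun s => by
        apply Subrepresentation.toSubmodule_injective
        ext v; simp
      right_inv := fun s => by
        apply Subrepresentation.toSubmodule_injective
        ext v; simp
      map_rel_iff' := by
        intro s t
        change (∀ v, e v ∈ s.toSubmodule → e v ∈ t.toSubmodule) ↔
          (∀ w, w ∈ s.toSubmodule → w ∈ t.toSubmodule)
        exact (e.surjective.forall (p := fun w => w ∈ s.toSubmodule → w ∈ t.toSubmodule)).symm }
  exact (OrderIso.isSimpleOrder_iff F).mpr hρ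

/-- Complete reducibility on the level of characters: every character of a finite group is a
combination of irreducible characters with natural coefficients. -/
theorem exists_character_eq_sum {G : Type u} [Group G] [Finite G] (d : ℕ) :
    ∀ (V : Type v) [AddCommGroup V] [Module ℂ V] [FiniteDimensional ℂ V]
      (ρ : Representation ℂ G V), finrank ℂ V = d →
      ∃ n : Irr G → ℕ, ∀ g, ρ.character g = ∑ χ, (n χ : ℂ) * χ.1 g := by
  classical
  induction d using Nat.strong_induction_on with
  | _ d ih =>
  intro V _ _ _ ρ hd
  by_cases h0 : Subsingleton V
  · refine ⟨0, fun g => ?_⟩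
    have : ρ g = 0 := Subsingleton.elim _ _
    simp [Representation.character, this]
  by_cases hirr : ρ.IsIrreducible
  · refine ⟨Pi.single ⟨ρ.character, character_mem_Irr ρ⟩ 1, fun g => ?_⟩
    rw [Finset.sum_eq_single ⟨ρ.character, character_mem_Irr ρ⟩]
    · simp
    · intro χ _ hχ; simp [Pi.single_eq_of_ne hχ]
    · simp
  have hnt : Nontrivial V := not_subsingleton_iff_nontrivial.mp h0
  have hnt' : Nontrivial (Subrepresentation ρ) :=
    ⟨⊥, ⊤, fun h => bot_ne_top (α := Submodule ℂ V)
      (congrArg Subrepresentation.toSubmodule h)⟩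
  obtain ⟨W, hW⟩ : ∃ W : Subrepresentation ρ, ¬ (W = ⊥ ∨ W = ⊤) := by
    by_contra! h
    exact hirr ⟨h⟩
  push Not at hW
  -- Invertibility of `|G|` is what Maschke's theorem needs in order to give semisimplicity.
  have : NeZero (Nat.card G : ℂ) := ⟨by exact_mod_cast Nat.card_pos.ne'⟩
  have hss : ρ.IsSemisimpleRepresentation := inferInstance
  obtain ⟨U, hU⟩ := hss.exists_isCompl W
  have hc : IsCompl W.toSubmodule U.toSubmodule := by
    constructor
    · rw [disjoint_iff]
      exact congrArg Subrepresentation.toSubmodule hU.inf_eq_bot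
    · rw [codisjoint_iff]
      exact congrArg Subrepresentation.toSubmodule hU.sup_eq_top
  have hWlt : finrank ℂ W.toSubmodule < d := hd ▸ Submodule.finrank_lt
    fun h => hW.2 (Subrepresentation.toSubmodule_injective h)
  have hUlt : finrank ℂ U.toSubmodule < d := hd ▸ Submodule.finrank_lt fun h => by
    rw [h] at hc
    exact hW.1 (Subrepresentation.toSubmodule_injective (inf_top_eq W.toSubmodule ▸ hc.inf_eq_bot))
  obtain ⟨n, hn⟩ := ih _ hWlt _ W.toRepresentation rfl
  obtain ⟨m, hm⟩ := ih _ hUlt _ U.toRepresentation rfl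
  refine ⟨n + m, fun g => ?_⟩
  have := trace_eq_add_of_isCompl hc (ρ g) (W.apply_mem_toSubmodule g)
    (U.apply_mem_toSubmodule g)
  calc ρ.character g = W.toRepresentation.character g + U.toRepresentation.character g := this
    _ = _ := by
      rw [hn, hm, ← Finset.sum_add_distrib]
      refine Finset.sum_congr rfl fun χ _ => ?_
      simp [add_mul]

/-! ### Orthogonality and the regular character -/

/-- Orthonormality of the irreducible characters. -/
theorem Irr.orthonormal {G : Type*} [Group G] [Fintype G] [DecidableEq (Irr G)] (χ ψ : Irr G) :
    (Nat.card G : ℂ)⁻¹ * ∑ g : G, χ.1 g * ψ.1 g⁻¹ = if χ = ψ then 1 else 0 := by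
  have hc : (Nat.card G : ℂ) ≠ 0 := by exact_mod_cast Nat.card_pos.ne'
  have : Invertible (Nat.card G : ℂ) := invertibleOfNonzero hc
  classical
  obtain ⟨χ, d, ρ, hρ, rfl⟩ := χ
  obtain ⟨ψ, e, σ, hσ, rfl⟩ := ψ
  have key := Representation.char_orthonormal ρ σ
  by_cases h : ρ.character = σ.character
  · have self := Representation.char_orthonormal ρ ρ
    rw [if_pos ⟨Representation.Equiv.refl ρ⟩] at self
    rw [if_pos (Subtype.ext h)]
    simpa [← h] using self
  · rw [if_neg (by rintro ⟨f⟩; exact h (Representation.char_iso f).symm)] at key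
    rwa [if_neg fun e => h (congrArg Subtype.val e)]

theorem Irr.linearIndependent (G : Type*) [Group G] [Finite G] :
    LinearIndependent ℂ (fun χ : Irr G => χ.1) := by
  classical
  have := Fintype.ofFinite G
  rw [Fintype.linearIndependent_iff]
  intro c hs ψ
  have h0 : (Nat.card G : ℂ)⁻¹ * ∑ g : G, (∑ χ : Irr G, c χ * χ.1 g) * ψ.1 g⁻¹ = 0 := by
    have h1 : ∀ g : G, ∑ χ, c χ * χ.1 g = 0 := fun g => by simpa using congrFun hs g
    simp [h1]
  have h2 : (Nat.card G : ℂ)⁻¹ * ∑ g : G, (∑ χ : Irr G, c χ * χ.1 g) * ψ.1 g⁻¹ =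
      ∑ χ : Irr G, c χ * ((Nat.card G : ℂ)⁻¹ * ∑ g : G, χ.1 g * ψ.1 g⁻¹) := by
    simp only [Finset.mul_sum, Finset.sum_mul]
    rw [Finset.sum_comm]
    refine Finset.sum_congr rfl fun g _ => Finset.sum_congr rfl fun χ _ => ?_
    ring
  simp only [Irr.orthonormal] at h2
  simpa using h2.symm.trans h0

/-- The permutation representation attached to a homomorphism into a symmetric group. -/
def permRep {G X : Type*} [Group G] (φ : G →* Equiv.Perm X) : Representation ℂ G (X → ℂ) where
  -- Precomposition reverses products; the inverse restores a left action.
  toFun g := LinearMap.funLeft ℂ ℂ ⇑(φ g)⁻¹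
  map_one' := by ext; simp
  map_mul' g h := by ext; simp [LinearMap.funLeft]

/-- A permutation character counts fixed points. -/
theorem permRep_character {G X : Type*} [Group G] [Fintype X] [DecidableEq X]
    (φ : G →* Equiv.Perm X) (g : G) :
    (permRep φ).character g = ((Finset.univ.filter fun x => φ g x = x).card : ℂ) := by
  rw [Representation.character, LinearMap.trace_eq_matrix_trace ℂ (Pi.basisFun ℂ X),
    Matrix.trace, Finset.card_filter]
  push_cast
  refine Finset.sum_congr rfl fun x _ => ?_
  simp only [Matrix.diag_apply, LinearMap.toMatrix_apply, Pi.basisFun_apply, Pi.basisFun_repr,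
    permRep, MonoidHom.coe_mk, OneHom.coe_mk, LinearMap.funLeft_apply, Pi.single_apply,
    Equiv.Perm.inv_eq_iff_eq]
  simp only [eq_comm]

/-- The decomposition of the regular character. -/
theorem sum_degree_mul_apply (G : Type*) [Group G] [Finite G] [DecidableEq G] (g : G) :
    ∑ χ : Irr G, χ.1 1 * χ.1 g = if g = 1 then (Nat.card G : ℂ) else 0 := by
  classical
  have := Fintype.ofFinite G
  have hc : (Nat.card G : ℂ) ≠ 0 := by exact_mod_cast Nat.card_pos.ne'
  have hreg : ∀ g : G, (permRep (MulAction.toPermHom G G)).character g =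
      if g = 1 then (Nat.card G : ℂ) else 0 := by
    intro g
    rw [permRep_character]
    by_cases h : g = 1
    · simp [h]
    · simp [h]
  obtain ⟨n, hn⟩ := exists_character_eq_sum _ _ (permRep (MulAction.toPermHom G G)) rfl
  -- Pairing the regular character with `ψ` leaves only the term at `1`, so the multiplicity of `ψ`
  -- is its degree.
  have hn' : ∀ ψ : Irr G, (n ψ : ℂ) = ψ.1 1 := by
    intro ψ
    have h1 : (Nat.card G : ℂ)⁻¹ * ∑ g : G, (∑ χ : Irr G, (n χ : ℂ) * χ.1 g) * ψ.1 g⁻¹ =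
        ∑ χ : Irr G, (n χ : ℂ) * ((Nat.card G : ℂ)⁻¹ * ∑ g : G, χ.1 g * ψ.1 g⁻¹) := by
      simp only [Finset.mul_sum, Finset.sum_mul]
      rw [Finset.sum_comm]
      refine Finset.sum_congr rfl fun g _ => Finset.sum_congr rfl fun χ _ => ?_
      ring
    simp only [Irr.orthonormal, ← hn, hreg] at h1
    simpa [hc] using h1.symm
  rw [← hreg, hn]
  simp [hn']

/-! ### Automorphisms of `ℂ` and rationality -/

/-- Uncountable algebraically closed extensions of a countable field that have the same cardinality
are isomorphic over it. -/
theorem exists_ringEquiv_algebraMap_eq {F : Type u} {L M : Type v} [Field F] [Field L] [Field M]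
    [IsAlgClosed L] [IsAlgClosed M] [Countable F] [Algebra F L] [Algebra F M] (hL : ℵ₀ < #L)
    (hLM : #L = #M) : ∃ σ : L ≃+* M, ∀ a, σ (algebraMap F L a) = algebraMap F M a := by
  obtain ⟨s, hs⟩ := exists_isTranscendenceBasis F L
  obtain ⟨t, ht⟩ := exists_isTranscendenceBasis F M
  -- Over a countable base, a transcendence basis of an uncountable algebraically closed field has
  -- the cardinality of the field.
  have hst : #s = #t := by
    have h1 := IsAlgClosed.cardinal_eq_cardinal_transcendence_basis_of_aleph0_lt _ hs
      Cardinal.mk_le_aleph0 hL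
    have h2 := IsAlgClosed.cardinal_eq_cardinal_transcendence_basis_of_aleph0_lt _ ht
      Cardinal.mk_le_aleph0 (hLM ▸ hL)
    rw [Cardinal.lift_id, Cardinal.lift_id] at h1 h2
    rw [← h1, ← h2, hLM]
  obtain ⟨e⟩ := Cardinal.eq.mp hst
  have := IsAlgClosed.isAlgClosure_of_transcendence_basis _ hs
  have := IsAlgClosed.isAlgClosure_of_transcendence_basis _ ht
  let ε := (hs.1.aevalEquiv.symm.trans (MvPolynomial.renameEquiv F e)).trans ht.1.aevalEquiv
  refine ⟨IsAlgClosure.equivOfEquiv L M ε.toRingEquiv, fun a => ?_⟩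
  have := IsAlgClosure.equivOfEquiv_algebraMap L M ε.toRingEquiv (algebraMap F _ a)
  rw [← IsScalarTower.algebraMap_apply] at this
  rw [this]
  change algebraMap _ M (ε (algebraMap F _ a)) = _
  rw [AlgEquiv.commutes, ← IsScalarTower.algebraMap_apply]

/-- Two embeddings of a countable field into an uncountable algebraically closed field differ by an
automorphism. -/
theorem exists_ringEquiv_comp_eq {F : Type u} {K : Type v} [Field F] [Field K] [IsAlgClosed K]
    [Countable F] (hK : ℵ₀ < #K) (f g : F →+* K) : ∃ σ : K ≃+* K, ∀ a, σ (f a) = g a :=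
  @exists_ringEquiv_algebraMap_eq F K K _ _ _ _ _ _ f.toAlgebra g.toAlgebra hK rfl

/-- A complex number which is algebraic and fixed by every automorphism of `ℂ` is rational. -/
theorem exists_rat_of_fixed {x : ℂ} (hx : IsIntegral ℚ x) (hfix : ∀ σ : ℂ ≃+* ℂ, σ x = x) :
    ∃ q : ℚ, x = q := by
  have hirr := minpoly.irreducible hx
  have : Fact (Irreducible (minpoly ℚ x)) := ⟨hirr⟩
  -- Sending the adjoined root to `x` or to `y` gives two embeddings of the countable field
  -- `ℚ[X]/(minpoly)`; an automorphism of `ℂ` relating them carries `x` to `y`.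
  have hroot : ∀ y : ℂ, (minpoly ℚ x).eval₂ (algebraMap ℚ ℂ) y = 0 → y = x := by
    intro y hy
    have hx0 : (minpoly ℚ x).eval₂ (algebraMap ℚ ℂ) x = 0 := minpoly.aeval ℚ x
    have : Countable (Polynomial ℚ) := by
      rw [← Cardinal.mk_le_aleph0_iff]
      simp
    have : Countable (AdjoinRoot (minpoly ℚ x)) :=
      (AdjoinRoot.mk_surjective (g := minpoly ℚ x)).countable
    obtain ⟨σ, hσ⟩ := exists_ringEquiv_comp_eq (K := ℂ)
      (by rw [Cardinal.mk_complex]; exact Cardinal.aleph0_lt_continuum)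
      (AdjoinRoot.lift (algebraMap ℚ ℂ) x hx0) (AdjoinRoot.lift (algebraMap ℚ ℂ) y hy)
    have := hσ (AdjoinRoot.root _)
    rw [AdjoinRoot.lift_root, AdjoinRoot.lift_root, hfix] at this
    exact this.symm
  -- Separability makes the roots distinct; all of them equal `x`, so the degree is one.
  have hsep : ((minpoly ℚ x).map (algebraMap ℚ ℂ)).Separable := hirr.separable.map
  have hdeg : ((minpoly ℚ x).map (algebraMap ℚ ℂ)).roots.card =
      ((minpoly ℚ x).map (algebraMap ℚ ℂ)).natDegree :=
    IsAlgClosed.card_roots_eq_natDegree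
  have hle : ((minpoly ℚ x).map (algebraMap ℚ ℂ)).roots ≤ {x} := by
    rw [Multiset.le_iff_subset (Polynomial.nodup_roots hsep)]
    intro y hy
    have := (Polynomial.mem_roots'.mp hy).2
    rw [Polynomial.IsRoot, Polynomial.eval_map] at this
    simpa using hroot y this
  have h1 : (minpoly ℚ x).natDegree ≤ 1 := by
    have := Multiset.card_le_card hle
    rw [hdeg, Polynomial.natDegree_map] at this
    simpa using this
  have h2 : (minpoly ℚ x).degree = 1 := by
    refine (Polynomial.degree_eq_iff_natDegree_eq_of_pos one_pos).mpr ?_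
    exact le_antisymm h1 (minpoly.natDegree_pos hx)
  obtain ⟨q, hq⟩ := minpoly.mem_range_of_degree_eq_one ℚ x h2
  exact ⟨q, hq.symm⟩

theorem exists_int_of_fixed {x : ℂ} (hx : IsIntegral ℤ x) (hfix : ∀ σ : ℂ ≃+* ℂ, σ x = x) :
    ∃ c : ℤ, x = c := by
  obtain ⟨q, rfl⟩ := exists_rat_of_fixed hx.tower_top hfix
  have hq : IsIntegral ℤ q := by
    rw [← isIntegral_algebraMap_iff (B := ℂ) (algebraMap ℚ ℂ).injective]
    exact hx
  obtain ⟨c, hc⟩ := IsIntegrallyClosed.isIntegral_iff.mp hq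
  exact ⟨c, by rw [← hc]; simp⟩

/-! ### Integrality of column sums -/

/-- Character values of finite groups are algebraic integers. -/
theorem isIntegral_character {G V : Type*} [Group G] [Finite G] [AddCommGroup V] [Module ℂ V]
    [FiniteDimensional ℂ V] (ρ : Representation ℂ G V) (g : G) :
    IsIntegral ℤ (ρ.character g) := by
  rw [Representation.character,
    Module.End.trace_eq_sum_roots_charpoly_of_splits (IsAlgClosed.splits _)]
  refine IsIntegral.multiset_sum fun μ hμ => ?_
  have hev : Module.End.HasEigenvalue (ρ g) μ := by
    rw [Module.End.hasEigenvalue_iff_isRoot_charpoly]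
    exact (Polynomial.mem_roots'.mp hμ).2
  -- As `ρ g` has finite order, its eigenvalues are roots of unity.
  obtain ⟨v, hv⟩ := hev.exists_hasEigenvector
  have hpow := hv.pow_apply (Nat.card G)
  rw [← map_pow, pow_card_eq_one', map_one, Module.End.one_apply] at hpow
  have h1 : μ ^ Nat.card G = 1 := by
    have : (μ ^ Nat.card G - 1) • v = 0 := by rw [sub_smul, ← hpow, one_smul, sub_self]
    exact sub_eq_zero.mp ((smul_eq_zero.mp this).resolve_right hv.2)
  exact IsIntegral.of_pow Nat.card_pos (h1 ▸ isIntegral_one)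

/-- Automorphisms of `ℂ` permute the irreducible characters. -/
theorem Irr.comp_ringEquiv_mem {G : Type*} [Group G] (σ : ℂ ≃+* ℂ) {χ : G → ℂ} (hχ : χ ∈ Irr G) :
    (fun g => σ (χ g)) ∈ Irr G := by
  obtain ⟨d, ρ, hρ, rfl⟩ := hχ
  -- Applying `σ` to coordinates is only semilinear, but conjugating `ρ g` by it is linear again and
  -- applies `σ` to the matrix entries.
  let e : (Fin d → ℂ) ≃+ (Fin d → ℂ) := AddEquiv.piCongrRight fun _ => σ.toAddEquiv
  have he : ∀ (c : ℂ) v, e (c • v) = σ c • e v := fun c v => by ext; simp [e]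
  have he' : ∀ (c : ℂ) v, e.symm (c • v) = σ.symm c • e.symm v := fun c v => by ext; simp [e]
  let τ : Representation ℂ G (Fin d → ℂ) :=
    { toFun := fun g =>
        { toFun := fun v => e (ρ g (e.symm v))
          map_add' := by simp
          map_smul' := by intro c v; simp [he, he'] }
      map_one' := by ext; simp
      map_mul' := fun g h => by ext; simp }
  have hτ : ∀ g v, τ g v = e (ρ g (e.symm v)) := fun _ _ => rfl
  refine ⟨d, τ, ?_, ?_⟩
  · let F : Subrepresentation τ ≃o Subrepresentation ρ :=
      { toFun := fun s => ⟨{ carrier := {v | e v ∈ s.toSubmodule}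
                             add_mem' := fun {a b} ha hb => by
                              simpa using s.toSubmodule.add_mem ha hb
                             zero_mem' := by simp
                             smul_mem' := fun c v hv => by
                              simpa [he] using s.toSubmodule.smul_mem (σ c) hv }, fun g v hv => by
          have := s.apply_mem_toSubmodule g hv
          simpa [hτ] using this⟩
        invFun := fun s => ⟨{ carrier := {v | e.symm v ∈ s.toSubmodule}
                              add_mem' := fun {a b} ha hb => by
                                simpa using s.toSubmodule.add_mem ha hb
                              zero_mem' := by simp
                              smul_mem' := fun c v hv => by
                                simpa [he'] using s.toSubmodule.smul_mem (σ.symm c) hv },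
          fun g v hv => by
          have := s.apply_mem_toSubmodule g hv
          simpa [hτ] using this⟩
        left_inv := fun s => by
          apply Subrepresentation.toSubmodule_injective
          ext v; simp
        right_inv := fun s => by
          apply Subrepresentation.toSubmodule_injective
          ext v; simp
        map_rel_iff' := by
          intro s t
          change (∀ v, e v ∈ s.toSubmodule → e v ∈ t.toSubmodule) ↔
            (∀ w, w ∈ s.toSubmodule → w ∈ t.toSubmodule)
          exact (e.surjective.forall (p := fun w => w ∈ s.toSubmodule → w ∈ t.toSubmodule)).symm }
    exact (OrderIso.isSimpleOrder_iff F).mpr hρ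
  · funext g
    rw [Representation.character, Representation.character,
      LinearMap.trace_eq_matrix_trace ℂ (Pi.basisFun ℂ (Fin d)),
      LinearMap.trace_eq_matrix_trace ℂ (Pi.basisFun ℂ (Fin d)), Matrix.trace, Matrix.trace,
      map_sum]
    refine Finset.sum_congr rfl fun i _ => ?_
    have : e.symm (Pi.single i 1) = Pi.single i 1 := by
      ext j; by_cases h : j = i
      · subst h; simp [e]
      · simp [e, h]
    simp only [Matrix.diag_apply, LinearMap.toMatrix_apply, Pi.basisFun_apply,
      Pi.basisFun_repr, hτ, this]
    simp [e]

theorem exists_int_sum_Irr_apply {G : Type*} [Group G] [Finite G] (g : G) :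
    ∃ c : ℤ, ∑ χ : Irr G, χ.1 g = c := by
  refine exists_int_of_fixed (IsIntegral.sum _ fun χ _ => ?_) fun σ => ?_
  · obtain ⟨_, d, ρ, -, rfl⟩ := χ
    exact isIntegral_character ρ g
  · rw [map_sum]
    have hinj : Function.Injective
        fun χ : Irr G => (⟨fun g => σ (χ.1 g), Irr.comp_ringEquiv_mem σ χ.2⟩ : Irr G) := by
      intro χ ψ h
      refine Subtype.ext (funext fun g => σ.injective ?_)
      exact congrFun (congrArg Subtype.val h) g
    exact (Equiv.ofBijective _ (Finite.injective_iff_bijective.mp hinj)).sum_comp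
      (fun χ : Irr G => χ.1 g)

/-! ### Degree bound from an abelian subgroup -/

/-- Commuting operators of a finite-dimensional complex representation have a common
eigenvector. -/
theorem exists_common_eigenvector {A V : Type*} [Group A] [IsMulCommutative A] [Finite A]
    [AddCommGroup V] [Module ℂ V] [FiniteDimensional ℂ V] [Nontrivial V]
    (ρ : Representation ℂ A V) : ∃ v : V, v ≠ 0 ∧ ∀ a, ∃ c : ℂ, ρ a v = c • v := by
  have : NeZero (Nat.card A : ℂ) := ⟨by exact_mod_cast Nat.card_pos.ne'⟩
  have hat : IsAtomic (Subrepresentation ρ) :=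
    (OrderIso.isAtomic_iff Subrepresentation.subrepresentationSubmoduleOrderIso).mpr inferInstance
  have hne : (⊤ : Subrepresentation ρ) ≠ ⊥ := fun h =>
    top_ne_bot (α := Submodule ℂ V) (congrArg Subrepresentation.toSubmodule h)
  obtain ⟨W, hW, -⟩ := (eq_bot_or_exists_atom_le (⊤ : Subrepresentation ρ)).resolve_left hne
  have hWne : W.toSubmodule ≠ ⊥ := fun h => hW.1 (Subrepresentation.toSubmodule_injective h)
  obtain ⟨v, hv, hv0⟩ := (Submodule.ne_bot_iff _).mp hWne
  refine ⟨v, hv0, fun a => ?_⟩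
  have : Nontrivial W.toSubmodule := (Submodule.nontrivial_iff_ne_bot).mpr hWne
  obtain ⟨μ, hμ⟩ := Module.End.exists_eigenvalue (W.toRepresentation a)
  obtain ⟨w, hw⟩ := hμ.exists_hasEigenvector
  have hwμ : ρ a w = μ • (w : V) := congrArg Subtype.val hw.apply_eq_smul
  -- Commutativity makes the eigenspace of `ρ a` invariant, so minimality of `W` forces `ρ a` to act
  -- on all of `W` by a scalar.
  let U : Subrepresentation ρ :=
    ⟨W.toSubmodule ⊓ Module.End.eigenspace (ρ a) μ, fun b u hu => by
      refine ⟨W.apply_mem_toSubmodule b hu.1, ?_⟩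
      rw [SetLike.mem_coe, Module.End.mem_eigenspace_iff]
      have hua := Module.End.mem_eigenspace_iff.mp hu.2
      rw [← Module.End.mul_apply, ← map_mul, mul_comm' a b, map_mul, Module.End.mul_apply, hua,
        map_smul]⟩
  have hUW : U = W := by
    refine (hW.le_iff.mp (show U ≤ W from fun x hx => hx.1)).resolve_left fun h => ?_
    have hwU : (w : V) ∈ U.toSubmodule := ⟨w.2, Module.End.mem_eigenspace_iff.mpr hwμ⟩
    rw [h] at hwU
    exact hw.2 (Subtype.ext ((Submodule.mem_bot ℂ).mp hwU))
  have hvU : v ∈ U.toSubmodule := hUW ▸ hv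
  exact ⟨μ, Module.End.mem_eigenspace_iff.mp hvU.2⟩

/-- The degree of an irreducible representation is at most the index of any abelian subgroup. -/
theorem finrank_le_index {G V : Type*} [Group G] [Finite G] [AddCommGroup V] [Module ℂ V]
    [FiniteDimensional ℂ V] (ρ : Representation ℂ G V) [hρ : ρ.IsIrreducible] (A : Subgroup G)
    (hA : IsMulCommutative A) : finrank ℂ V ≤ A.index := by
  have hV : Nontrivial V := by
    by_contra h
    rw [not_nontrivial_iff_subsingleton] at h
    exact bot_ne_top (α := Subrepresentation ρ)
      (Subrepresentation.toSubmodule_injective (Subsingleton.elim _ _))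
  obtain ⟨v, hv0, hv⟩ := exists_common_eigenvector (ρ.comp A.subtype)
  have := Fintype.ofFinite (G ⧸ A)
  -- Changing the coset representative only rescales `ρ g v`, since `A` acts on `v` by scalars.
  -- Hence these `[G : A]` vectors span an invariant subspace.
  let b : G ⧸ A → V := fun q => ρ q.out v
  have hb : ∀ g : G, ∃ c : ℂ, ρ g v = c • b g := by
    intro g
    obtain ⟨a, ha⟩ := QuotientGroup.mk_out_eq_mul A g
    obtain ⟨c, hc⟩ := hv a⁻¹
    refine ⟨c, ?_⟩
    have hg : g = (g : G ⧸ A).out * ((a⁻¹ : A) : G) := by rw [ha]; simp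
    have hc' : ρ ((a⁻¹ : A) : G) v = c • v := hc
    calc ρ g v = ρ ((g : G ⧸ A).out * ((a⁻¹ : A) : G)) v := by rw [← hg]
      _ = c • b g := by rw [map_mul, Module.End.mul_apply, hc', map_smul]
  let W : Subrepresentation ρ := ⟨Submodule.span ℂ (Set.range b), fun g w hw => by
    induction hw using Submodule.span_induction with
    | mem x hx =>
      obtain ⟨q, rfl⟩ := hx
      obtain ⟨c, hc⟩ := hb (g * q.out)
      have : ρ g (b q) = c • b ((g * q.out : G) : G ⧸ A) := by
        rw [← hc, map_mul, Module.End.mul_apply]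
      rw [this]
      exact Submodule.smul_mem _ _ (Submodule.subset_span ⟨_, rfl⟩)
    | zero => simp
    | add x y _ _ hx hy => rw [map_add]; exact Submodule.add_mem _ hx hy
    | smul c x _ hx => rw [map_smul]; exact Submodule.smul_mem _ _ hx⟩
  have hW : W = ⊤ := by
    refine (hρ.eq_bot_or_eq_top W).resolve_left fun h => hv0 ?_
    obtain ⟨c, hc⟩ := hb 1
    have hmem : v ∈ W.toSubmodule := by
      rw [map_one, Module.End.one_apply] at hc
      rw [hc]
      exact Submodule.smul_mem _ _ (Submodule.subset_span ⟨_, rfl⟩)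
    rw [h] at hmem
    exact (Submodule.mem_bot ℂ).mp hmem
  have htop : Submodule.span ℂ (Set.range b) = ⊤ := congrArg Subrepresentation.toSubmodule hW
  calc finrank ℂ V = finrank ℂ (Submodule.span ℂ (Set.range b)) := by rw [htop, finrank_top]
    _ ≤ Fintype.card (G ⧸ A) := finrank_range_le_card b
    _ = A.index := by rw [Subgroup.index, Nat.card_eq_fintype_card]

/-- Degrees of irreducible characters. -/
theorem Irr.exists_degree {G : Type*} [Group G] [Finite G] (χ : Irr G) :
    ∃ d : ℕ, χ.1 1 = d ∧ 1 ≤ d ∧ ∀ A : Subgroup G, IsMulCommutative A → d ≤ A.index := by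
  obtain ⟨_, d, ρ, hρ, rfl⟩ := χ
  refine ⟨d, by simp, ?_, fun A hA => ?_⟩
  · rw [Nat.one_le_iff_ne_zero]
    rintro rfl
    exact bot_ne_top (α := Subrepresentation ρ)
      (Subrepresentation.toSubmodule_injective (Subsingleton.elim _ _))
  · simpa using finrank_le_index ρ A hA

/-! ### Row sums and the bounds on the table sum -/

theorem one_mem_Irr (G : Type*) [Group G] : (1 : G → ℂ) ∈ Irr G := by
  have hs : IsSimpleOrder (Subrepresentation (Representation.trivial ℂ G ℂ)) :=
    { exists_pair_ne := ⟨⊥, ⊤, fun h => bot_ne_top (α := Submodule ℂ ℂ)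
        (congrArg Subrepresentation.toSubmodule h)⟩
      eq_bot_or_eq_top := fun W => (eq_bot_or_eq_top W.toSubmodule).imp
        (fun h => Subrepresentation.toSubmodule_injective h)
        (fun h => Subrepresentation.toSubmodule_injective h) }
  have : (Representation.trivial ℂ G ℂ).character = 1 := by
    funext g
    simp [Representation.character]
  rw [← this]
  exact character_mem_Irr _

@[simp]
theorem charTable_mk {G : Type*} [Group G] (χ : Irr G) (g : G) :
    charTable G χ (ConjClasses.mk g) = χ.1 g := rfl

/-- The rows pull back along `ConjClasses.mk` to the independent characters, so they are independent
in a space whose dimension is the number of classes. The reverse inequality is not needed. -/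
theorem card_Irr_le_card_conjClasses (G : Type*) [Group G] [Finite G] :
    Nat.card (Irr G) ≤ Nat.card (ConjClasses G) := by
  have := Fintype.ofFinite (ConjClasses G)
  have hli : LinearIndependent ℂ (fun χ : Irr G => charTable G χ) := by
    refine LinearIndependent.of_comp (LinearMap.funLeft ℂ ℂ (ConjClasses.mk : G → ConjClasses G)) ?_
    exact Irr.linearIndependent G
  have := hli.fintype_card_le_finrank
  rwa [finrank_fintype_fun_eq_card, ← Nat.card_eq_fintype_card, ← Nat.card_eq_fintype_card] at this

/-- The number of fixed points of conjugation by `g` times the size of the class of `g`. -/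
theorem card_class_mul_card_commuting {G : Type*} [Group G] [Fintype G] [DecidableEq G]
    [DecidableEq (ConjClasses G)] (g : G) :
    (Finset.univ.filter fun h : G => ConjClasses.mk h = ConjClasses.mk g).card *
      (Finset.univ.filter fun x : G => g⁻¹ * x * g = x).card = Nat.card G := by
  classical
  have h := MulAction.card_orbit_mul_card_stabilizer_eq_card_group (ConjAct G) g
  rw [ConjAct.card, ← Nat.card_eq_fintype_card] at h
  rw [← Nat.card_eq_fintype_card (α := G)] at h
  rw [← h]
  congr 1
  · rw [Nat.card_eq_fintype_card, ← Set.toFinset_card]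
    congr 1
    ext x
    simp [ConjAct.mem_orbit_conjAct, ConjClasses.mk_eq_mk_iff_isConj]
  · rw [← Nat.card_eq_fintype_card, ← Subgroup.nat_card_centralizer_nat_card_stabilizer]
    refine (Nat.subtype_card _ fun x => ?_).symm
    rw [Finset.mem_filter_univ, Subgroup.mem_centralizer_singleton_iff, mul_assoc,
      inv_mul_eq_iff_eq_mul]

/-- Row sums of the character table are natural numbers: they are multiplicities in the
permutation character of the conjugation action. -/
theorem exists_nat_row_sum {G : Type*} [Group G] [Finite G] [Fintype (ConjClasses G)]
    (χ : Irr G) : ∃ m : ℕ, ∑ C, charTable G χ C = m := by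
  classical
  have := Fintype.ofFinite G
  have hc : (Nat.card G : ℂ) ≠ 0 := by exact_mod_cast Nat.card_pos.ne'
  have : Invertible (Nat.card G : ℂ) := invertibleOfNonzero hc
  obtain ⟨d, ρ, hρ, hχ⟩ := χ.2
  let π := permRep ((MulAction.toPermHom (MulAut G) G).comp (MulAut.conj : G →* MulAut G))
  refine ⟨finrank ℂ (Representation.IntertwiningMap π ρ), ?_⟩
  rw [← Representation.card_inv_mul_sum_char_mul_char_eq_finrank, eq_inv_mul_iff_mul_eq₀ hc, hχ,
    ← Finset.sum_fiberwise Finset.univ (ConjClasses.mk : G → ConjClasses G), Finset.mul_sum]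
  refine Finset.sum_congr rfl fun C _ => ?_
  obtain ⟨g, rfl⟩ := ConjClasses.exists_rep C
  -- The summand is constant on each class, so the class of `g` contributes its size times `χ(g)
  -- |C_G(g)|`, which is `|G| χ(g)`.
  have hterm : ∀ h ∈ Finset.univ.filter fun h : G => ConjClasses.mk h = ConjClasses.mk g,
      χ.1 h * π.character h⁻¹ = χ.1 g * π.character g⁻¹ := by
    intro h hh
    have hconj := ConjClasses.mk_eq_mk_iff_isConj.mp (Finset.mem_filter.mp hh).2
    obtain ⟨c, rfl⟩ := isConj_iff.mp hconj.symm
    rw [Irr.apply_eq_of_isConj χ.2 hconj]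
    congr 1
    rw [← π.char_conj g⁻¹ c]
    group
  rw [Finset.sum_congr rfl hterm, Finset.sum_const, nsmul_eq_mul, permRep_character,
    charTable_mk, ← card_class_mul_card_commuting g]
  have hfix : (Finset.univ.filter fun x : G => ((MulAction.toPermHom (MulAut G) G).comp
      (MulAut.conj : G →* MulAut G)) g⁻¹ x = x) =
      Finset.univ.filter fun x : G => g⁻¹ * x * g = x := by
    ext x; simp
  rw [hfix]
  push_cast
  ring

/-- After exchanging the sums, the regular character kills every column but that of the identity. -/
theorem sum_degree_mul_row_sum (G : Type*) [Group G] [Finite G] [Fintype (ConjClasses G)] :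
    ∑ χ : Irr G, χ.1 1 * ∑ C, charTable G χ C = (Nat.card G : ℂ) := by
  classical
  simp only [Finset.mul_sum]
  rw [Finset.sum_comm, Finset.sum_eq_single (ConjClasses.mk (1 : G))]
  · simp only [charTable_mk]
    simpa using sum_degree_mul_apply G 1
  · intro C _ hC
    obtain ⟨g, rfl⟩ := ConjClasses.exists_rep C
    simp only [charTable_mk]
    rw [sum_degree_mul_apply, if_neg fun h => hC (by rw [h])]
  · simp

/-- The sum of the entries of the character table is an integer between
`max |Irr(G)| |A|` and `|G|` for every abelian subgroup `A`. -/
theorem exists_nat_tableSum {G : Type*} [Group G] [Finite G] :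
    ∃ s : ℕ, tableSum G = s ∧ Nat.card (Irr G) ≤ s ∧ s ≤ Nat.card G ∧
      ∀ A : Subgroup G, IsMulCommutative A → Nat.card A ≤ s := by
  classical
  let : Fintype (ConjClasses G) := Fintype.ofFinite _
  choose m hm using fun χ : Irr G => exists_nat_row_sum χ
  choose d hd hd1 hdA using fun χ : Irr G => Irr.exists_degree χ
  have hdm : ∑ χ, d χ * m χ = Nat.card G := by
    have := sum_degree_mul_row_sum G
    simp only [hm, hd] at this
    exact_mod_cast this
  refine ⟨∑ χ, m χ, ?_, ?_, ?_, fun A hA => ?_⟩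
  · change ∑ χ : Irr G, ∑ C : ConjClasses G, charTable G χ C = _
    simp [hm]
  · let χ₁ : Irr G := ⟨1, one_mem_Irr G⟩
    have h1 : m χ₁ = Nat.card (ConjClasses G) := by
      have hrow : ∀ C, charTable G χ₁ C = 1 := by
        intro C
        obtain ⟨g, rfl⟩ := ConjClasses.exists_rep C
        rfl
      have := hm χ₁
      simp only [hrow, Finset.sum_const, Finset.card_univ, nsmul_eq_mul, mul_one] at this
      rw [Nat.card_eq_fintype_card]
      exact_mod_cast this.symm
    calc Nat.card (Irr G) ≤ Nat.card (ConjClasses G) := card_Irr_le_card_conjClasses G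
      _ = m χ₁ := h1.symm
      _ ≤ ∑ χ, m χ := Finset.single_le_sum (fun _ _ => Nat.zero_le _) (Finset.mem_univ _)
  · rw [← hdm]
    exact Finset.sum_le_sum fun χ _ => Nat.le_mul_of_pos_left _ (hd1 χ)
  · have hle : A.index * Nat.card A ≤ A.index * ∑ χ, m χ := by
      rw [A.index_mul_card, ← hdm, Finset.mul_sum]
      exact Finset.sum_le_sum fun χ _ => Nat.mul_le_mul_right _ (hdA χ A hA)
    exact Nat.le_of_mul_le_mul_left hle (Nat.pos_of_ne_zero A.index_ne_zero_of_finite)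

/-! ### The dihedral example -/

/-- A nonabelian group of order `8` has at least five irreducible characters as soon as it has an
abelian subgroup of order `4`. -/
theorem five_le_card_Irr {G : Type*} [Group G] [Finite G] (hG : Nat.card G = 8) (A : Subgroup G)
    (hA : IsMulCommutative A) (hA4 : Nat.card A = 4) : 5 ≤ Nat.card (Irr G) := by
  classical
  choose d hd hd1 hdA using fun χ : Irr G => Irr.exists_degree χ
  have hidx : A.index = 2 := by
    have := A.index_mul_card
    rw [hA4, hG] at this
    omega
  have hsum : ∑ χ, d χ * d χ = 8 := by
    have := sum_degree_mul_apply G 1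
    simp only [hd, if_true, hG] at this
    exact_mod_cast this
  -- Degrees are 1 or 2, so `n + 3k = 8` with `k` the number of characters of degree 2.
  have hsq : ∀ χ, d χ * d χ = 1 + 3 * if d χ = 2 then 1 else 0 := by
    intro χ
    have h2 := hdA χ A hA
    have h1 := hd1 χ
    rw [hidx] at h2
    interval_cases d χ <;> rfl
  -- The trivial character gives `k < n`, which rules out `n = k = 2`.
  have hlt : (Finset.univ.filter fun χ => d χ = 2).card < Nat.card (Irr G) := by
    rw [Nat.card_eq_fintype_card, ← Finset.card_univ]
    refine Finset.card_lt_card (Finset.filter_ssubset.mpr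
      ⟨⟨1, one_mem_Irr G⟩, Finset.mem_univ _, ?_⟩)
    intro h
    have := hd ⟨1, one_mem_Irr G⟩
    rw [h] at this
    norm_num at this
  simp only [hsq, Finset.sum_add_distrib, ← Finset.mul_sum, ← Finset.card_filter,
    Finset.sum_const, Finset.card_univ, ← Nat.card_eq_fintype_card, smul_eq_mul, mul_one] at hsum
  omega

/-- In the dihedral group of order `8` the rotations form an abelian subgroup of maximal order. -/
theorem exists_isMaxOrderAbelian_dihedralGroup_four :
    ∃ A : Subgroup (DihedralGroup 4), IsMaxOrderAbelian A ∧ Nat.card A = 4 := by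
  have hA4 : Nat.card (Subgroup.zpowers (DihedralGroup.r 1 : DihedralGroup 4)) = 4 := by
    rw [Nat.card_zpowers, DihedralGroup.orderOf_r_one]
  refine ⟨_, ⟨inferInstance, fun B hB => ?_⟩, hA4⟩
  rw [hA4]
  have hcard : Nat.card (DihedralGroup 4) = 8 := DihedralGroup.nat_card
  have hidx := B.index_mul_card
  -- The whole group is not abelian, so an abelian `B` has index at least 2 and order at most 4.
  have hne : B.index ≠ 1 := by
    intro h
    rw [Subgroup.index_eq_one] at h
    subst h
    have hcomm := congrArg Subtype.val (mul_comm' (⟨DihedralGroup.r 1, trivial⟩ :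
      (⊤ : Subgroup (DihedralGroup 4))) ⟨DihedralGroup.sr 0, trivial⟩)
    exact absurd hcomm (by decide)
  have h0 : B.index ≠ 0 := B.index_ne_zero_of_finite
  have h2 : 2 ≤ B.index := by omega
  have := Nat.mul_le_mul_right (Nat.card B) h2
  omega

end OrdinaryCharacterTable

theorem mainTheorem8 :
    (∀ (G : Type*) [Group G] [Finite G],
      (∀ A : Subgroup G, OrdinaryCharacterTable.IsMaxOrderAbelian A →
        ∃ s : ℤ, OrdinaryCharacterTable.tableSum G = (s : ℂ) ∧
          max (Nat.card (OrdinaryCharacterTable.Irr G) : ℤ) (Nat.card A : ℤ) ≤ s ∧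
          s ≤ (Nat.card G : ℤ)) ∧
      (∀ C : ConjClasses G, ∃ c : ℤ, OrdinaryCharacterTable.columnSum G C = (c : ℂ))) ∧
    (∃ (H : Type) (_ : Group H) (_ : Finite H) (A : Subgroup H),
      OrdinaryCharacterTable.IsMaxOrderAbelian A ∧
        Nat.card A < Nat.card (OrdinaryCharacterTable.Irr H)) := by
  refine ⟨fun G _ _ => ⟨fun A hA => ?_, fun C => ?_⟩, ?_⟩
  · obtain ⟨s, hs, hn, hG, hab⟩ := OrdinaryCharacterTable.exists_nat_tableSum (G := G)
    refine ⟨s, by simpa using hs, max_le ?_ ?_, ?_⟩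
    · exact_mod_cast hn
    · exact_mod_cast hab A hA.1
    · exact_mod_cast hG
  · obtain ⟨g, rfl⟩ := ConjClasses.exists_rep C
    exact OrdinaryCharacterTable.exists_int_sum_Irr_apply g
  · obtain ⟨A, hA, hA4⟩ := OrdinaryCharacterTable.exists_isMaxOrderAbelian_dihedralGroup_four
    refine ⟨DihedralGroup 4, inferInstance, inferInstance, A, hA, ?_⟩
    have := OrdinaryCharacterTable.five_le_card_Irr DihedralGroup.nat_card A hA.1 hA4
    omega
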